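/- Let $a\le b$ be real numbers, $\Theta:=\mathbb R^2\times[a,b]$, and for $\theta=(\alpha,\beta,\zeta)\in\Theta$ and $x=(y,z)\in\mathbb R^2$ put $m_\theta(x):=-(y-\alpha\mathbf 1_{z\le\zeta}-\beta\mathbf 1_{z>\zeta})^2$. For a measure $\mu$ write $\mu(\varphi)=\int\varphi\,d\mu$. For a function $W:\Theta\to\mathbb R$ that is càdlàg in $\zeta$, a point $(\alpha,\beta,\zeta)\in\Theta$ is called a maximizer of $W$ if $W(\alpha,\beta,\zeta)\vee W(\alpha,\beta,\zeta^-)=\sup_\Theta W$ (with $W(\alpha,\beta,a^-):=W(\alpha,\beta,a)$), and a smallest argmax of $W$ is a maximizer with the smallest $\zeta$. Let $\mathbb P$ be the law of a random vector $(Y,Z)$ with $Y=\alpha_0\mathbf 1_{Z\le\zeta_0}+\beta_0\mathbf 1_{Z>\zeta_0}+\epsilon$, where $\alpha_0\ne\beta_0$, $\zeta_0\in[a,b]$, $\theta_0:=(\alpha_0,\beta_0,\zeta_0)$, the variables $Z$ and $\epsilon$ are independent and have continuous (atomless) distributions, $\epsilon$ has zero expectation, finite positive variance and finite third absolute moment,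 $\mathbb P(Z<a)>0$, $\mathbb P(Z>b)>0$, and for some $\eta,\kappa>0$ the law of $Z$ has on $[a,b]\cup[\zeta_0-\eta,\zeta_0+\eta]$ a density $f$ that is bounded and strictly positive on $[a,b]$ and greater than $\kappa$ on $[\zeta_0-\eta,\zeta_0+\eta]$. Let $(m_n)$ be a nondecreasing sequence of positive integers with $m_n\to\infty$, let $\mathbb Q_n$ be probability measures on $\mathbb R^2$ with $\mathbb Q_n(y^2)<\infty$, and let $X_{n,1},\dots,X_{n,m_n}$ be, for each $n$, independent random vectors with common law $\mathbb Q_n$, all defined on one probability space $(\Omega,\mathcal A,\mathbf P)$. Let $\theta_n=(\alpha_n,\beta_n,\zeta_n)$ be a smallest argmax over $\Theta$ of $\theta\mapsto\mathbb Q_n(m_\theta)$, let $\mathbb P_n^*$ be the empirical measure of $X_{n,1},\dots,X_{n,m_n}$, and let the least squares estimator $\theta_n^*$ be a smallest argmax over $\Theta$ of $\theta\mapsto\mathbb P_n^*(m_\theta)$. Let $M>0$ be such that $|\alpha_n|\le M$ for all $n$, and put $$\mathcal F:=\{(y,z)\mapsto\mathbf 1_I(z): I\subset\mathbb R\text{ an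 interval}\},\quad \mathcal G:=\{yf:f\in\mathcal F\}\cup\{|y+\alpha|f:f\in\mathcal F,\ |\alpha|\le M\},\quad \mathcal H:=\{y^2f:f\in\mathcal F\}.$$ For a class $\mathcal C$ of functions write $\|\mathbb Q_n-\mathbb P\|_{\mathcal C}:=\sup_{\varphi\in\mathcal C}|\mathbb Q_n(\varphi)-\mathbb P(\varphi)|$. Assume (I) $\|\mathbb Q_n-\mathbb P\|_{\mathcal F}\to0$, (II) $\|\mathbb Q_n-\mathbb P\|_{\mathcal G}\to0$, (III) $\|\mathbb Q_n-\mathbb P\|_{\mathcal H}\to0$, (IV) $\theta_n\to\theta_0$. Then $\theta_n^*\to\theta_0$ in probability. -/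

import Mathlib

open Set Filter Topology MeasureTheory ProbabilityTheory
open scoped ENNReal

noncomputable section

namespace ChangePoint

/-- A point of the plane is written `x = (y, z)`; a parameter is written `θ = (α, β, ζ)`.
The regression function `α 1_{z ≤ ζ} + β 1_{z > ζ}`. -/
def regression (θ : ℝ × ℝ × ℝ) (z : ℝ) : ℝ :=
  θ.1 * (Iic θ.2.2).indicator 1 z + θ.2.1 * (Ioi θ.2.2).indicator 1 z

/-- The residual `y - α 1_{z ≤ ζ} - β 1_{z > ζ}`. -/
def residual (θ : ℝ × ℝ × ℝ) (x : ℝ × ℝ) : ℝ :=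
  x.1 - regression θ x.2

/-- The least squares criterion `m_θ(x) = -(y - α 1_{z ≤ ζ} - β 1_{z > ζ})²`. -/
def mFun (θ : ℝ × ℝ × ℝ) (x : ℝ × ℝ) : ℝ :=
  -(residual θ x) ^ 2

/-- The function `θ ↦ μ(m_θ)`. -/
def criterion (μ : Measure (ℝ × ℝ)) (θ : ℝ × ℝ × ℝ) : ℝ :=
  ∫ x, mFun θ x ∂μ

/-- The parameter space `Θ = ℝ² × [a, b]`. -/
def paramSpace (a b : ℝ) : Set (ℝ × ℝ × ℝ) :=
  {θ | θ.2.2 ∈ Icc a b}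

/-- The left limit `W(α, β, ζ⁻)` in the third coordinate, for a function `W` on `ℝ² × [a, b]` that
is càdlàg in that coordinate. At the left endpoint `ζ = a` of the interval there is nothing to the
left, and `W(α, β, a⁻)` is `W(α, β, a)`. -/
def leftValue (a : ℝ) (W : ℝ × ℝ × ℝ → ℝ) (θ : ℝ × ℝ × ℝ) : ℝ :=
  open Classical in
  if a < θ.2.2 then Function.leftLim (fun s : ℝ => W (θ.1, θ.2.1, s)) θ.2.2 else W θ

/-- `θ ∈ Θ` is a maximizer of `W` if `W(α, β, ζ) ∨ W(α, β, ζ⁻) = sup_Θ W`. -/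
def IsMaximizer (a b : ℝ) (W : ℝ × ℝ × ℝ → ℝ) (θ : ℝ × ℝ × ℝ) : Prop :=
  θ ∈ paramSpace a b ∧ IsLUB (W '' paramSpace a b) (max (W θ) (leftValue a W θ))

/-- `θ` is a smallest argmax of `W` over `Θ`: a maximizer with the smallest `ζ`. -/
def IsSargmax (a b : ℝ) (W : ℝ × ℝ × ℝ → ℝ) (θ : ℝ × ℝ × ℝ) : Prop :=
  IsMaximizer a b W θ ∧ ∀ θ', IsMaximizer a b W θ' → θ.2.2 ≤ θ'.2.2

/-- The empirical measure of the points `x 0, …, x (m - 1)`. -/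
def empiricalMeasure {m : ℕ} (x : Fin m → ℝ × ℝ) : Measure (ℝ × ℝ) :=
  (m : ℝ≥0∞)⁻¹ • ∑ k, Measure.dirac (x k)

/-- `P`, the law of `(Y, Z)`, follows the change-point model
`Y = α₀ 1_{Z ≤ ζ₀} + β₀ 1_{Z > ζ₀} + ε` with parameter `θ₀ = (α₀, β₀, ζ₀)`. Here `Z` is the second
coordinate and `ε` the residual at `θ₀`. -/
structure IsModel (a b : ℝ) (P : Measure (ℝ × ℝ)) (θ₀ : ℝ × ℝ × ℝ) : Prop where
  alpha_ne_beta : θ₀.1 ≠ θ₀.2.1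
  zeta_mem : θ₀.2.2 ∈ Icc a b
  /-- `ε` is independent of `Z`. -/
  indep : IndepFun (residual θ₀) Prod.snd P
  /-- `ε` has a continuous distribution. -/
  eps_noAtoms : ∀ t : ℝ, P.map (residual θ₀) {t} = 0
  /-- `ε` has finite variance, which is positive, zero expectation, and a finite third absolute
  moment. -/
  eps_memLp : MemLp (residual θ₀) 2 P
  eps_mean : ∫ x, residual θ₀ x ∂P = 0
  eps_var : 0 < variance (residual θ₀) P
  eps_third : Integrable (fun x => |residual θ₀ x| ^ 3) P
  /-- `Z` has a continuous distribution. -/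
  z_noAtoms : ∀ t : ℝ, P.map Prod.snd {t} = 0
  /-- On `[a, b]` and around `ζ₀` the law of `Z` has a density `f`, which is bounded and strictly
  positive on `[a, b]` and bounded away from zero around `ζ₀`. -/
  z_density : ∃ (f : ℝ → ℝ) (C η κ : ℝ), Measurable f ∧ 0 < η ∧ 0 < κ ∧
    (∀ z ∈ Icc a b, 0 < f z ∧ f z ≤ C) ∧
    (∀ z, |z - θ₀.2.2| ≤ η → κ < f z) ∧
    ∀ B : Set ℝ, MeasurableSet B → B ⊆ Icc a b ∪ {z | |z - θ₀.2.2| ≤ η} →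
      P.map Prod.snd B = ∫⁻ z in B, ENNReal.ofReal (f z)
  /-- `P(Z < a) > 0` and `P(Z > b) > 0`. -/
  z_lt : 0 < P {x | x.2 < a}
  z_gt : 0 < P {x | b < x.2}

/-- The class of the functions `(y, z) ↦ 1_I(z)`, for `I` an interval of any kind. -/
def classF : Set (ℝ × ℝ → ℝ) :=
  {φ | ∃ I : Set ℝ, I.OrdConnected ∧ φ = fun x => I.indicator 1 x.2}

/-- The class of the functions `y 1_I(z)` and `|y + α| 1_I(z)` with `|α| ≤ M`. -/
def classG (M : ℝ) : Set (ℝ × ℝ → ℝ) :=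
  {φ | ∃ f ∈ classF, φ = fun x => x.1 * f x} ∪
    {φ | ∃ f ∈ classF, ∃ α : ℝ, |α| ≤ M ∧ φ = fun x => |x.1 + α| * f x}

/-- The class of the functions `y² 1_I(z)`. -/
def classH : Set (ℝ × ℝ → ℝ) :=
  {φ | ∃ f ∈ classF, φ = fun x => x.1 ^ 2 * f x}

/-- `‖Q - P‖_𝓒 = sup {|Q(φ) - P(φ)| : φ ∈ 𝓒}`, with values in `[0, ∞]`. -/
def classDist (𝓒 : Set (ℝ × ℝ → ℝ)) (Q P : Measure (ℝ × ℝ)) : ℝ≥0∞ :=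
  ⨆ φ ∈ 𝓒, ENNReal.ofReal |∫ x, φ x ∂Q - ∫ x, φ x ∂P|

end ChangePoint

end

/-! This is an argmax argument. Up to the constant `-ν(y²)`, the criterion of a law `ν` is a
quadratic `gain` in the levels `α`, `β`, with coefficients built from `ν(z ≤ ζ)`, `ν(y 1_{z ≤ ζ})`
and `ν(y)`. If these are uniformly close to their values under `P`, then every maximizer is close to
`θ₀` (`IsModel.exists_dist_lt_of_isMaximizer`). Mass on both sides of `[a, b]` makes the criterion
coercive in the levels, which confines them to a compact set. There the criterion of `P` is
continuous and has `θ₀` as its only maximizer, hence a gap outside each ball around `θ₀`.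

With probability tending to one the empirical measures are this close to `P`. Chebyshev's inequality
gives convergence at each fixed `ζ` (`withHighProb_empiricalMeasure`), and Pólya's argument makes it
uniform in `ζ` (`exists_finset_forall_abs_sub_lt`). Second moments enter only as a variance bound,
since `ν(y²)` cancels when two values of the criterion are compared. -/

noncomputable section

namespace ChangePoint

/-! ### Events of probability tending to one. -/

section HighProbability

variable {Ω : Type*} [MeasurableSpace Ω] {μ : Measure Ω}

/-- `p n` holds with (inner) probability tending to one. -/
def WithHighProb (μ : Measure Ω) (p : ℕ → Ω → Prop) : Prop :=
  Tendsto (fun n => μ {ω | ¬ p n ω}) atTop (𝓝 0)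

/-- Monotonicity of the outer measure suffices, so no event about the estimator has to be
measurable. -/
theorem WithHighProb.mono_ae {p q : ℕ → Ω → Prop} (hp : WithHighProb μ p)
    (h : ∀ n, ∀ᵐ ω ∂μ, p n ω → q n ω) : WithHighProb μ q := by
  refine tendsto_of_tendsto_of_tendsto_of_le_of_le tendsto_const_nhds hp
    (fun _ => zero_le) fun n => measure_mono_ae ?_
  filter_upwards [h n] with ω hω hq using fun hpω => hq (hω hpω)

theorem WithHighProb.mono {p q : ℕ → Ω → Prop} (hp : WithHighProb μ p)
    (h : ∀ n ω, p n ω → q n ω) : WithHighProb μ q :=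
  hp.mono_ae fun n => Eventually.of_forall (h n)

theorem WithHighProb.and {p q : ℕ → Ω → Prop} (hp : WithHighProb μ p) (hq : WithHighProb μ q) :
    WithHighProb μ fun n ω => p n ω ∧ q n ω := by
  have h := Tendsto.add hp hq
  rw [add_zero] at h
  refine tendsto_of_tendsto_of_tendsto_of_le_of_le tendsto_const_nhds h
    (fun _ => zero_le) fun n => le_trans (measure_mono ?_) (measure_union_le _ _)
  intro ω hω
  by_cases hpω : p n ω
  · exact Or.inr fun hqω => hω ⟨hpω, hqω⟩
  · exact Or.inl hpω

theorem WithHighProb.finset_forall {ι : Type*} (s : Finset ι) {p : ι → ℕ → Ω → Prop}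
    (hp : ∀ i ∈ s, WithHighProb μ (p i)) : WithHighProb μ fun n ω => ∀ i ∈ s, p i n ω := by
  classical
  induction s using Finset.induction_on with
  | empty => simp [WithHighProb]
  | insert i s _ ih =>
    refine ((hp i (by simp)).and (ih fun j hj => hp j (by simp [hj]))).mono fun n ω h j hj => ?_
    rcases Finset.mem_insert.1 hj with rfl | hj
    · exact h.1
    · exact h.2 j hj

theorem tendstoInMeasure_of_withHighProb {E : Type*} [PseudoMetricSpace E] {f : ℕ → Ω → E} {c : E}
    (h : ∀ ε > 0, WithHighProb μ fun n ω => dist (f n ω) c < ε) :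
    TendstoInMeasure μ f atTop fun _ => c := by
  rw [tendstoInMeasure_iff_dist]
  intro ε hε
  simpa [WithHighProb] using h ε hε

end HighProbability

/-! ### A weak law of large numbers for the rows of the array. -/

section EmpiricalMeasure

theorem integral_empiricalMeasure {m : ℕ} (x : Fin m → ℝ × ℝ) (φ : ℝ × ℝ → ℝ) :
    ∫ z, φ z ∂empiricalMeasure x = (m : ℝ)⁻¹ * ∑ k, φ (x k) := by
  rw [empiricalMeasure, integral_smul_measure, integral_finsetSum_measure]
  · simp
  · exact fun k _ => integrable_dirac (by simp)

theorem integrable_empiricalMeasure {m : ℕ} (hm : 0 < m) (x : Fin m → ℝ × ℝ) (φ : ℝ × ℝ → ℝ) :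
    Integrable φ (empiricalMeasure x) := by
  refine Integrable.smul_measure ?_ (by simp [hm.ne'])
  rw [integrable_finsetSum_measure]
  exact fun k _ => integrable_dirac (by simp)

theorem isProbabilityMeasure_empiricalMeasure {m : ℕ} (hm : 0 < m) (x : Fin m → ℝ × ℝ) :
    IsProbabilityMeasure (empiricalMeasure x) := by
  constructor
  simp [empiricalMeasure, ENNReal.inv_mul_cancel, hm.ne']

/-- Chebyshev's inequality: pairwise independence within a row bounds the variance of the empirical
mean by `B / m n`, eventually in `n`. -/
theorem withHighProb_empiricalMeasure {Ω : Type*} [MeasurableSpace Ω] {μ : Measure Ω}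
    [IsProbabilityMeasure μ] {m : ℕ → ℕ} (hm_pos : ∀ n, 0 < m n) (hm : Tendsto m atTop atTop)
    {Q : ℕ → Measure (ℝ × ℝ)} [∀ n, IsProbabilityMeasure (Q n)]
    {X : (n : ℕ) → Fin (m n) → Ω → ℝ × ℝ}
    (hX_law : ∀ n k, HasLaw (X n k) (Q n) μ) (hX_indep : ∀ n, iIndepFun (X n) μ)
    {φ : ℝ × ℝ → ℝ} (hφ : Measurable φ) (hφQ : ∀ n, MemLp φ 2 (Q n))
    {B : ℝ} (hB : ∀ᶠ n in atTop, ∫ x, φ x ^ 2 ∂Q n ≤ B)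
    {c : ℝ} (hc : Tendsto (fun n => ∫ x, φ x ∂Q n) atTop (𝓝 c)) {δ : ℝ} (hδ : 0 < δ) :
    WithHighProb μ fun n ω => |∫ x, φ x ∂empiricalMeasure (fun k => X n k ω) - c| < δ := by
  have hY : ∀ n k, MemLp (fun ω => φ (X n k ω)) 2 μ := fun n k => by
    have h := hφQ n
    rw [← (hX_law n k).map_eq] at h
    exact h.comp_of_map (hX_law n k).aemeasurable
  set S : ℕ → Ω → ℝ := fun n ω => ∫ x, φ x ∂empiricalMeasure (fun k => X n k ω) with hS
  have hS' : ∀ n, S n = fun ω => (m n : ℝ)⁻¹ * ∑ k, φ (X n k ω) :=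
    fun n => funext fun ω => integral_empiricalMeasure _ _
  have hSL : ∀ n, MemLp (S n) 2 μ := fun n => by
    rw [hS']
    exact (memLp_finsetSum _ fun k _ => hY n k).const_mul _
  have hmR : ∀ n, (m n : ℝ) ≠ 0 := fun n => by exact_mod_cast (hm_pos n).ne'
  have hmean : ∀ n, ∫ ω, S n ω ∂μ = ∫ x, φ x ∂Q n := fun n => by
    have hk : ∀ k, ∫ ω, φ (X n k ω) ∂μ = ∫ x, φ x ∂Q n := fun k =>
      (hX_law n k).integral_comp hφ.aestronglyMeasurable
    rw [hS', integral_const_mul, integral_finsetSum _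
      fun k _ => (hY n k).integrable (by norm_num)]
    simp [hk, hmR n]
  have hvar : ∀ᶠ n in atTop, variance (S n) μ ≤ (m n : ℝ)⁻¹ * B := by
    filter_upwards [hB] with n hn
    have hk : ∀ k, variance (fun ω => φ (X n k ω)) μ ≤ B := fun k => by
      refine (variance_le_expectation_sq (hY n k).aestronglyMeasurable).trans ?_
      have : ∫ ω, φ (X n k ω) ^ 2 ∂μ = ∫ x, φ x ^ 2 ∂Q n :=
        (hX_law n k).integral_comp (f := fun x => φ x ^ 2) (hφ.pow_const 2).aestronglyMeasurable
      exact this.le.trans hn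
    have hsum : variance (fun ω => ∑ k, φ (X n k ω)) μ
        = ∑ k, variance (fun ω => φ (X n k ω)) μ := by
      have := IndepFun.variance_sum (μ := μ) (s := Finset.univ)
        (X := fun k ω => φ (X n k ω)) (fun k _ => hY n k)
        (fun i _ j _ hij => ((hX_indep n).indepFun hij).comp hφ hφ)
      rw [← this]
      congr 1
      ext ω
      simp
    rw [hS', variance_const_mul, hsum]
    calc ((m n : ℝ)⁻¹) ^ 2 * ∑ k, variance (fun ω => φ (X n k ω)) μ
        ≤ ((m n : ℝ)⁻¹) ^ 2 * ∑ _k : Fin (m n), B := by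
          gcongr with k _
          exact hk k
      _ = (m n : ℝ)⁻¹ * B := by
          have := hmR n
          simp
          field_simp
  have hlim : Tendsto (fun n => ENNReal.ofReal ((m n : ℝ)⁻¹ * B / (δ / 2) ^ 2)) atTop (𝓝 0) := by
    have h1 : Tendsto (fun n => (m n : ℝ)⁻¹) atTop (𝓝 0) :=
      tendsto_inv_atTop_zero.comp (tendsto_natCast_atTop_atTop.comp hm)
    have h2 := ENNReal.tendsto_ofReal ((h1.mul_const B).div_const ((δ / 2) ^ 2))
    simpa using h2
  refine tendsto_of_tendsto_of_tendsto_of_le_of_le' tendsto_const_nhds hlim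
    (Eventually.of_forall fun _ => zero_le) ?_
  filter_upwards [hvar, Metric.tendsto_nhds.1 hc (δ / 2) (half_pos hδ)] with n hn hcn
  rw [Real.dist_eq] at hcn
  -- The bias is below `δ / 2`, so a deviation of `δ` from `c` forces a fluctuation of at least `δ /
  -- 2` around the mean.
  calc μ {ω | ¬ |S n ω - c| < δ}
      ≤ μ {ω | δ / 2 ≤ |S n ω - ∫ ω, S n ω ∂μ|} := by
        refine measure_mono fun ω hω => ?_
        have hω' : δ ≤ |S n ω - c| := not_lt.1 hω
        have := abs_sub_le (S n ω) (∫ x, φ x ∂Q n) c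
        simp only [mem_ofPred_eq, hmean]
        linarith
    _ ≤ ENNReal.ofReal (variance (S n) μ / (δ / 2) ^ 2) :=
        meas_ge_le_variance_div_sq (hSL n) (half_pos hδ)
    _ ≤ _ := by gcongr

end EmpiricalMeasure

/-! ### Uniform closeness of half-plane integrals. -/

/-- Pólya's argument: near a continuous monotone function, closeness of a monotone function at
finitely many points forces uniform closeness on a compact interval. -/
theorem exists_finset_forall_abs_sub_lt {F : ℝ → ℝ} (hF : Continuous F) (hFm : Monotone F)
    (a b : ℝ) {δ : ℝ} (hδ : 0 < δ) :
    ∃ s : Finset ℝ, ∀ G : ℝ → ℝ, Monotone G → (∀ t ∈ s, |G t - F t| < δ / 2) →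
      ∀ t ∈ Icc a b, |G t - F t| < δ := by
  classical
  have hnear : ∀ t : ℝ, ∃ u v, u < t ∧ t < v ∧ F v - F u < δ / 2 := fun t => by
    obtain ⟨r, hr, h⟩ := Metric.continuous_iff.1 hF t (δ / 4) (by linarith)
    have h1 := h (t - r / 2) (by rw [Real.dist_eq, abs_lt]; constructor <;> linarith)
    have h2 := h (t + r / 2) (by rw [Real.dist_eq, abs_lt]; constructor <;> linarith)
    rw [Real.dist_eq, abs_lt] at h1 h2
    exact ⟨t - r / 2, t + r / 2, by linarith, by linarith, by linarith [h1.1, h2.2]⟩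
  choose u v hu hv huv using hnear
  obtain ⟨c, -, hc⟩ := (isCompact_Icc (a := a) (b := b)).elim_nhds_subcover
    (fun t => Ioo (u t) (v t)) fun t _ => Ioo_mem_nhds (hu t) (hv t)
  -- For `t` between `u i` and `v i`, monotonicity traps `G t` between `G (u i)` and `G (v i)`. Each
  -- of these is within `δ / 2` of `F`, and `F` grows by less than `δ / 2` from `u i` to `v i`.
  refine ⟨c.image u ∪ c.image v, fun G hG h t ht => ?_⟩
  obtain ⟨i, hi, hti⟩ := mem_iUnion₂.1 (hc ht)
  have h1 := abs_lt.1 (h (u i)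
    (Finset.mem_union_left _ (Finset.mem_image_of_mem u hi)))
  have h2 := abs_lt.1 (h (v i)
    (Finset.mem_union_right _ (Finset.mem_image_of_mem v hi)))
  have := hG hti.1.le
  have := hG hti.2.le
  have := hFm hti.1.le
  have := hFm hti.2.le
  have := huv i
  rw [abs_lt]
  constructor <;> linarith [h1.1, h2.2]

/-- The integral of `φ` over the half-plane `z ≤ t`. -/
def lowerIntegral (μ : Measure (ℝ × ℝ)) (φ : ℝ × ℝ → ℝ) (t : ℝ) : ℝ :=
  ∫ x, φ x * (Iic t).indicator 1 x.2 ∂μ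

theorem measurable_indicator_Iic_snd (t : ℝ) :
    Measurable fun x : ℝ × ℝ => (Iic t).indicator (1 : ℝ → ℝ) x.2 :=
  (measurable_one.indicator measurableSet_Iic).comp measurable_snd

theorem abs_mul_indicator_Iic_le (c t z : ℝ) : |c * (Iic t).indicator (1 : ℝ → ℝ) z| ≤ |c| := by
  by_cases h : z ≤ t <;> simp [h]

theorem integrable_mul_indicator_Iic {μ : Measure (ℝ × ℝ)} {φ : ℝ × ℝ → ℝ} (hφ : Integrable φ μ)
    (t : ℝ) : Integrable (fun x => φ x * (Iic t).indicator 1 x.2) μ :=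
  hφ.mono (hφ.aestronglyMeasurable.mul (measurable_indicator_Iic_snd t).aestronglyMeasurable)
    (Eventually.of_forall fun _ => abs_mul_indicator_Iic_le _ _ _)

theorem monotone_lowerIntegral {μ : Measure (ℝ × ℝ)} {φ : ℝ × ℝ → ℝ} (hφ : Integrable φ μ)
    (hφ0 : ∀ x, 0 ≤ φ x) : Monotone (lowerIntegral μ φ) := fun s t hst => by
  refine integral_mono (integrable_mul_indicator_Iic hφ s)
    (integrable_mul_indicator_Iic hφ t) fun x => ?_
  refine mul_le_mul_of_nonneg_left ?_ (hφ0 x)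
  exact indicator_le_indicator_of_subset (Iic_subset_Iic.2 hst) (fun _ => zero_le_one) _

/-- Dominated convergence: off the line `z = t`, which is null, the indicator is constant for `s`
near `t`. -/
theorem continuous_lowerIntegral {μ : Measure (ℝ × ℝ)} {φ : ℝ × ℝ → ℝ} (hφ : Integrable φ μ)
    (hμ : ∀ t : ℝ, μ.map Prod.snd {t} = 0) : Continuous (lowerIntegral μ φ) := by
  refine continuous_iff_continuousAt.2 fun t => continuousAt_of_dominated
    (bound := fun x => |φ x|)
    (Eventually.of_forall fun s => (integrable_mul_indicator_Iic hφ s).aestronglyMeasurable)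
    (Eventually.of_forall fun s => Eventually.of_forall fun _ => abs_mul_indicator_Iic_le _ _ _)
    hφ.abs ?_
  have h0 : ∀ᵐ x ∂μ, x.2 ≠ t := by
    have := hμ t
    rw [Measure.map_apply measurable_snd (measurableSet_singleton t)] at this
    exact measure_eq_zero_iff_ae_notMem.1 this
  filter_upwards [h0] with x hx
  refine continuousAt_const.mul ?_
  rcases lt_or_gt_of_ne hx with h | h
  · refine (continuousAt_const (y := (1 : ℝ))).congr ?_
    filter_upwards [Ioi_mem_nhds h] with s hs
    have : x.2 ≤ s := le_of_lt hs
    simp [this]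
  · refine (continuousAt_const (y := (0 : ℝ))).congr ?_
    filter_upwards [Iio_mem_nhds h] with s hs
    have : ¬ x.2 ≤ s := not_le.2 hs
    simp [this]

/-! ### The criterion as a quadratic function of the levels. -/

/-- The criterion, up to the additive constant `-μ(y²)`, as a function of the regression levels and
of `p = μ(z ≤ ζ)`, `A = μ(y 1_{z ≤ ζ})`, `T = μ(y)`. -/
def gain (α β p A T : ℝ) : ℝ :=
  2 * α * A - α ^ 2 * p + 2 * β * (T - A) - β ^ 2 * (1 - p)

theorem abs_gain_sub_gain_le {α β p A T p' A' T' R δ : ℝ} (hα : |α| ≤ R) (hβ : |β| ≤ R)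
    (hp : |p - p'| ≤ δ) (hA : |A - A'| ≤ δ) (hT : |T - T'| ≤ δ) :
    |gain α β p A T - gain α β p' A' T'| ≤ (6 * R + 2 * R ^ 2) * δ := by
  have hR : 0 ≤ R := (abs_nonneg α).trans hα
  have hα2 : α ^ 2 ≤ R ^ 2 := sq_le_sq' (abs_le.1 hα).1 (abs_le.1 hα).2
  have hβ2 : β ^ 2 ≤ R ^ 2 := sq_le_sq' (abs_le.1 hβ).1 (abs_le.1 hβ).2
  have h1 : |α * (A - A')| ≤ R * δ := by rw [abs_mul]; gcongr
  have h2 : |β * (A - A')| ≤ R * δ := by rw [abs_mul]; gcongr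
  have h3 : |β * (T - T')| ≤ R * δ := by rw [abs_mul]; gcongr
  have h4 : |α ^ 2 * (p - p')| ≤ R ^ 2 * δ := by rw [abs_mul, abs_of_nonneg (sq_nonneg α)]; gcongr
  have h5 : |β ^ 2 * (p - p')| ≤ R ^ 2 * δ := by rw [abs_mul, abs_of_nonneg (sq_nonneg β)]; gcongr
  rw [abs_le] at *
  unfold gain
  constructor <;> nlinarith only [h1, h2, h3, h4, h5]

/-- Coercivity: the gain splits into two concave quadratics, one in each level, with leading
coefficients at most `-c`. Each is at most `K² / c`, so a lower bound on the sum bounds both levels.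
-/
theorem exists_abs_le_of_le_gain {c : ℝ} (hc : 0 < c) {K : ℝ} (hK : 0 ≤ K) (L : ℝ) :
    ∃ R, ∀ α β p A T, c ≤ p → p ≤ 1 - c → |A| ≤ K → |T - A| ≤ K → L ≤ gain α β p A T →
      |α| ≤ R ∧ |β| ≤ R := by
  have hlow : ∀ x : ℝ, -(K ^ 2 / c) ≤ c * x ^ 2 - 2 * K * x := fun x => by
    have : c * x ^ 2 - 2 * K * x + K ^ 2 / c = (c * x - K) ^ 2 / c := by field_simp; ring
    have := div_nonneg (sq_nonneg (c * x - K)) hc.le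
    linarith
  -- Beyond this threshold `x > 1` and `c x - 2 K > c + N`, so the product `x (c x - 2 K)` exceeds
  -- `N`.
  have hbd : ∀ x : ℝ, c * x ^ 2 - 2 * K * x ≤ |L| + K ^ 2 / c →
      x ≤ 1 + (2 * K + (|L| + K ^ 2 / c)) / c := fun x hx => by
    set N := |L| + K ^ 2 / c with hN
    have hN0 : 0 ≤ N := by positivity
    by_contra! h
    have h0 : 0 ≤ (2 * K + N) / c := by positivity
    have h1 : c + (2 * K + N) < c * x := by
      have := mul_lt_mul_of_pos_left h hc
      rwa [mul_add, mul_one, mul_div_cancel₀ _ hc.ne'] at this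
    nlinarith
  refine ⟨1 + (2 * K + (|L| + K ^ 2 / c)) / c, fun α β p A T hp hp' hA hB hL => ?_⟩
  have h1 : α * A ≤ |α| * K := (le_abs_self _).trans (by rw [abs_mul]; gcongr)
  have h2 : β * (T - A) ≤ |β| * K := (le_abs_self _).trans (by rw [abs_mul]; gcongr)
  have h3 : c * |α| ^ 2 ≤ α ^ 2 * p := by rw [sq_abs, mul_comm]; gcongr
  have h4 : c * |β| ^ 2 ≤ β ^ 2 * (1 - p) := by
    rw [sq_abs, mul_comm]
    have : c ≤ 1 - p := by linarith
    gcongr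
  have h5 := hlow |α|
  have h6 := hlow |β|
  have h7 := neg_abs_le L
  unfold gain at hL
  constructor <;> refine hbd _ ?_ <;> linarith

theorem criterion_eq {μ : Measure (ℝ × ℝ)} [IsProbabilityMeasure μ]
    (h1 : Integrable (fun x : ℝ × ℝ => x.1) μ) (h2 : Integrable (fun x : ℝ × ℝ => x.1 ^ 2) μ)
    (θ : ℝ × ℝ × ℝ) :
    criterion μ θ = gain θ.1 θ.2.1 (lowerIntegral μ (fun _ => 1) θ.2.2)
      (lowerIntegral μ (fun x => x.1) θ.2.2) (∫ x, x.1 ∂μ) - ∫ x, x.1 ^ 2 ∂μ := by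
  obtain ⟨α, β, ζ⟩ := θ
  have hp := integrable_mul_indicator_Iic (integrable_const (μ := μ) (1 : ℝ)) ζ
  have hA := integrable_mul_indicator_Iic h1 ζ
  have hpt : ∀ x : ℝ × ℝ, mFun (α, β, ζ) x =
      (2 * (α - β)) * (x.1 * (Iic ζ).indicator 1 x.2)
        + (β ^ 2 - α ^ 2) * (1 * (Iic ζ).indicator 1 x.2) + (2 * β) * x.1 - β ^ 2 - x.1 ^ 2 := by
    rintro ⟨y, z⟩
    by_cases h : z ≤ ζ
    · simp [mFun, residual, regression, h]; ring
    · simp [mFun, residual, regression, h, not_le.1 h]; ring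
  simp_rw [criterion, hpt]
  have i₁ := (hA.const_mul (2 * (α - β))).add (hp.const_mul (β ^ 2 - α ^ 2))
  have i₂ := i₁.add (h1.const_mul (2 * β))
  have i₃ := i₂.sub (integrable_const (β ^ 2))
  rw [integral_sub, integral_sub, integral_add, integral_add, integral_const_mul,
    integral_const_mul, integral_const_mul (2 * β)]
  · simp only [integral_const, probReal_univ, smul_eq_mul, gain, lowerIntegral]
    ring
  exacts [hA.const_mul _, hp.const_mul _, i₁, h1.const_mul _, i₂, integrable_const _, i₃, h2]

/-- The parameter of a maximizer can be moved slightly in the third coordinate so that it nearly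
maximizes in the ordinary sense. -/
theorem IsMaximizer.exists_near {a b : ℝ} {W : ℝ × ℝ × ℝ → ℝ} {θ : ℝ × ℝ × ℝ}
    (h : IsMaximizer a b W θ) {ε : ℝ} (hε : 0 < ε) :
    ∃ s ∈ Icc a b, |s - θ.2.2| < ε ∧
      ∀ θ' ∈ paramSpace a b, W θ' - ε < W (θ.1, θ.2.1, s) := by
  obtain ⟨α, β, ζ⟩ := θ
  obtain ⟨hζ, hlub⟩ := h
  have hub : ∀ θ' ∈ paramSpace a b, W θ' ≤ max (W (α, β, ζ)) (leftValue a W (α, β, ζ)) :=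
    fun θ' hθ' => hlub.1 (mem_image_of_mem W hθ')
  suffices ∃ s ∈ Icc a b, |s - ζ| < ε ∧
      max (W (α, β, ζ)) (leftValue a W (α, β, ζ)) - ε < W (α, β, s) by
    obtain ⟨s, hs, hsζ, hsW⟩ := this
    exact ⟨s, hs, hsζ, fun θ' hθ' => by linarith [hub θ' hθ']⟩
  have htriv : ∀ v, v ≤ W (α, β, ζ) → ∃ s ∈ Icc a b, |s - ζ| < ε ∧ v - ε < W (α, β, s) :=
    fun v hv => ⟨ζ, hζ, by simpa using hε, by linarith⟩
  rcases le_total (leftValue a W (α, β, ζ)) (W (α, β, ζ)) with hle | hle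
  · exact htriv _ (by rw [max_eq_left hle])
  rw [max_eq_right hle]
  by_cases ha : a < ζ
  · simp only [leftValue, ha, if_true]
    by_cases hex : ∃ y, Tendsto (fun s => W (α, β, s)) (𝓝[<] ζ) (𝓝 y)
    · obtain ⟨y, hy⟩ := hex
      rw [leftLim_eq_of_tendsto hy]
      have h1 : ∀ᶠ s in 𝓝[<] ζ, y - ε < W (α, β, s) := hy.eventually (lt_mem_nhds (by linarith))
      have h2 : ∀ᶠ s in 𝓝[<] ζ, s ∈ Ioo (max a (ζ - ε)) ζ :=
        Ioo_mem_nhdsLT (max_lt ha (by linarith))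
      obtain ⟨s, hs1, hs2⟩ := (h1.and h2).exists
      have h3 := max_lt_iff.1 hs2.1
      have h4 := hs2.2
      refine ⟨s, ⟨h3.1.le, h4.le.trans hζ.2⟩, ?_, hs1⟩
      rw [abs_lt]
      constructor <;> linarith
    -- Where no left limit exists, `Function.leftLim` is by convention the value of the function, so
    -- `s = ζ` serves.
    · rw [leftLim_eq_of_not_tendsto _ hex]
      exact htriv _ le_rfl
  · simp only [leftValue, ha, if_false]
    exact htriv _ le_rfl

/-! ### Identifiability of `θ₀` under `P` and stability of maximizers. -/

section Model

variable {a b : ℝ} {P : Measure (ℝ × ℝ)} {θ₀ : ℝ × ℝ × ℝ}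

theorem measurable_regression (θ : ℝ × ℝ × ℝ) : Measurable (regression θ) :=
  ((measurable_one.indicator measurableSet_Iic).const_mul _).add
    ((measurable_one.indicator measurableSet_Ioi).const_mul _)

theorem measurable_residual (θ : ℝ × ℝ × ℝ) : Measurable (residual θ) :=
  measurable_fst.sub ((measurable_regression θ).comp measurable_snd)

theorem regression_of_le {θ : ℝ × ℝ × ℝ} {z : ℝ} (h : z ≤ θ.2.2) : regression θ z = θ.1 := by
  simp [regression, h]

theorem regression_of_lt {θ : ℝ × ℝ × ℝ} {z : ℝ} (h : θ.2.2 < z) : regression θ z = θ.2.1 := by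
  simp [regression, h]

theorem abs_regression_le (θ : ℝ × ℝ × ℝ) (z : ℝ) : |regression θ z| ≤ max |θ.1| |θ.2.1| := by
  rcases le_or_gt z θ.2.2 with h | h
  · rw [regression_of_le h]; exact le_max_left _ _
  · rw [regression_of_lt h]; exact le_max_right _ _

theorem memLp_regression [IsProbabilityMeasure P] (θ : ℝ × ℝ × ℝ) (q : ℝ≥0∞) :
    MemLp (fun x : ℝ × ℝ => regression θ x.2) q P :=
  MemLp.of_bound ((measurable_regression θ).comp measurable_snd).aestronglyMeasurable _
    (Eventually.of_forall fun x => abs_regression_le θ x.2)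

theorem IsModel.memLp_fst [IsProbabilityMeasure P] (hP : IsModel a b P θ₀) :
    MemLp (fun x : ℝ × ℝ => x.1) 2 P := by
  have h := hP.eps_memLp.add (memLp_regression θ₀ 2)
  refine h.congr_norm measurable_fst.aestronglyMeasurable (Eventually.of_forall fun x => ?_)
  simp [residual]

/-- Pythagoras: the error is centred and independent of `Z`, so it is orthogonal to the difference
of the regression functions. -/
theorem IsModel.criterion_sub [IsProbabilityMeasure P] (hP : IsModel a b P θ₀) (θ : ℝ × ℝ × ℝ) :
    criterion P θ₀ - criterion P θ
      = ∫ x, (regression θ₀ x.2 - regression θ x.2) ^ 2 ∂P := by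
  set g : ℝ → ℝ := fun z => regression θ₀ z - regression θ z with hg
  have hgm : Measurable g := (measurable_regression θ₀).sub (measurable_regression θ)
  have hgL : MemLp (fun x : ℝ × ℝ => g x.2) 2 P :=
    (memLp_regression θ₀ 2).sub (memLp_regression θ 2)
  have hε2 : Integrable (fun x => residual θ₀ x ^ 2) P := hP.eps_memLp.integrable_sq
  have hg2 : Integrable (fun x : ℝ × ℝ => g x.2 ^ 2) P := hgL.integrable_sq
  have hεg : Integrable (fun x => residual θ₀ x * g x.2) P := hP.eps_memLp.integrable_mul hgL
  have hind : IndepFun (residual θ₀) (fun x : ℝ × ℝ => g x.2) P :=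
    hP.indep.comp measurable_id hgm
  have h0 : ∫ x, residual θ₀ x * g x.2 ∂P = 0 := by
    rw [hind.integral_fun_mul_eq_mul_integral (measurable_residual θ₀).aestronglyMeasurable
      (hgm.comp measurable_snd).aestronglyMeasurable, hP.eps_mean, zero_mul]
  have hpt : ∀ x, mFun θ x = -(residual θ₀ x ^ 2) - 2 * (residual θ₀ x * g x.2) - g x.2 ^ 2 :=
    fun x => by simp only [mFun, residual, hg]; ring
  have hθ : criterion P θ = -(∫ x, residual θ₀ x ^ 2 ∂P) - ∫ x, g x.2 ^ 2 ∂P := by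
    simp_rw [criterion, hpt]
    rw [integral_sub, integral_sub, integral_neg, integral_const_mul, h0]
    · ring
    exacts [hε2.neg, hεg.const_mul 2, hε2.neg.sub (hεg.const_mul 2), hg2]
  have hθ₀ : criterion P θ₀ = -(∫ x, residual θ₀ x ^ 2 ∂P) := by
    simp_rw [criterion, mFun]
    rw [integral_neg]
  rw [hθ, hθ₀]
  ring

theorem IsModel.measure_snd_mem_pos (hP : IsModel a b P θ₀) {u v : ℝ} (hau : a ≤ u) (huv : u < v)
    (hvb : v ≤ b) : P {x | x.2 ∈ Ioc u v} ≠ 0 := by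
  obtain ⟨f, C, η, κ, hf, -, -, hpos, -, hdens⟩ := hP.z_density
  have hsub : Ioc u v ⊆ Icc a b := fun z hz => ⟨hau.trans hz.1.le, hz.2.trans hvb⟩
  have h := hdens (Ioc u v) measurableSet_Ioc (hsub.trans subset_union_left)
  rw [Measure.map_apply measurable_snd measurableSet_Ioc] at h
  intro h0
  have h0' : P (Prod.snd ⁻¹' Ioc u v) = 0 := h0
  rw [h0', eq_comm, setLIntegral_eq_zero_iff measurableSet_Ioc hf.ennreal_ofReal] at h
  have hv : volume (Ioc u v) = 0 := by
    refine measure_mono_null ?_ (ae_iff.1 h)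
    intro z hz hcon
    exact absurd (hcon hz) (by simpa using (hpos z (hsub hz)).1)
  rw [Real.volume_Ioc, ENNReal.ofReal_eq_zero] at hv
  linarith

/-- Otherwise the two regression functions agree almost surely. The events `Z < a` and `Z > b` then
identify the levels, and between distinct thresholds, where `Z` has positive mass, the functions
would differ because `α₀ ≠ β₀`. -/
theorem IsModel.criterion_lt [IsProbabilityMeasure P] (hP : IsModel a b P θ₀) {θ : ℝ × ℝ × ℝ}
    (hθ : θ ∈ paramSpace a b) (hne : θ ≠ θ₀) : criterion P θ < criterion P θ₀ := by
  have hsub := hP.criterion_sub θ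
  set D : ℝ × ℝ → ℝ := fun x => (regression θ₀ x.2 - regression θ x.2) ^ 2 with hD
  have hDi : Integrable D P := ((memLp_regression θ₀ 2).sub (memLp_regression θ 2)).integrable_sq
  have hD0 : 0 ≤ D := fun x => sq_nonneg _
  by_contra! hle
  have hzero : ∀ᵐ x ∂P, regression θ₀ x.2 = regression θ x.2 := by
    have h0 : ∫ x, D x ∂P = 0 := le_antisymm (by linarith) (integral_nonneg hD0)
    filter_upwards [(integral_eq_zero_iff_of_nonneg hD0 hDi).1 h0] with x hx
    exact sub_eq_zero.1 (pow_eq_zero_iff two_ne_zero |>.1 hx)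
  have hmeet : ∀ s : Set (ℝ × ℝ), P s ≠ 0 → ∃ x ∈ s, regression θ₀ x.2 = regression θ x.2 :=
    fun s hs => by
      by_contra! hcon
      exact hs (measure_mono_null hcon (ae_iff.1 hzero))
  have hζ₀ := hP.zeta_mem
  have hζ : θ.2.2 ∈ Icc a b := hθ
  have hα : θ₀.1 = θ.1 := by
    obtain ⟨x, hx, h⟩ := hmeet _ hP.z_lt.ne'
    have hx' : x.2 < a := hx
    rwa [regression_of_le (hx'.le.trans hζ₀.1), regression_of_le (hx'.le.trans hζ.1)] at h
  have hβ : θ₀.2.1 = θ.2.1 := by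
    obtain ⟨x, hx, h⟩ := hmeet _ hP.z_gt.ne'
    have hx' : b < x.2 := hx
    rwa [regression_of_lt (hζ₀.2.trans_lt hx'), regression_of_lt (hζ.2.trans_lt hx')] at h
  rcases lt_trichotomy θ.2.2 θ₀.2.2 with hlt | heq | hlt
  · obtain ⟨x, hx, h⟩ := hmeet _ (hP.measure_snd_mem_pos hζ.1 hlt hζ₀.2)
    rw [regression_of_le hx.2, regression_of_lt hx.1, ← hβ] at h
    exact hP.alpha_ne_beta h
  · exact hne (Prod.ext hα.symm (Prod.ext hβ.symm heq))
  · obtain ⟨x, hx, h⟩ := hmeet _ (hP.measure_snd_mem_pos hζ₀.1 hlt hζ.2)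
    rw [regression_of_lt hx.1, regression_of_le hx.2, ← hα] at h
    exact hP.alpha_ne_beta h.symm

theorem IsModel.continuous_criterion [IsProbabilityMeasure P] (hP : IsModel a b P θ₀) :
    Continuous (criterion P) := by
  have h1 : Integrable (fun x : ℝ × ℝ => x.1) P := hP.memLp_fst.integrable (by norm_num)
  have hp := continuous_lowerIntegral (integrable_const (μ := P) (1 : ℝ)) hP.z_noAtoms
  have hA := continuous_lowerIntegral h1 hP.z_noAtoms
  rw [funext (criterion_eq h1 hP.memLp_fst.integrable_sq)]
  unfold gain
  fun_prop

/-- Bounding the levels leaves a compact set outside the ball, on which the continuous criterion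
attains a maximum, strictly below its value at `θ₀`. -/
theorem IsModel.exists_gap [IsProbabilityMeasure P] (hP : IsModel a b P θ₀) (R : ℝ) {ε : ℝ}
    (hε : 0 < ε) :
    ∃ η > 0, ∀ θ ∈ paramSpace a b, |θ.1| ≤ R → |θ.2.1| ≤ R →
      criterion P θ₀ - η < criterion P θ → dist θ θ₀ < ε := by
  set K : Set (ℝ × ℝ × ℝ) := (Icc (-R) R ×ˢ Icc (-R) R ×ˢ Icc a b) \ Metric.ball θ₀ ε with hK
  have hKc : IsCompact K :=
    (isCompact_Icc.prod (isCompact_Icc.prod isCompact_Icc)).diff Metric.isOpen_ball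
  have hmem : ∀ θ ∈ paramSpace a b, |θ.1| ≤ R → |θ.2.1| ≤ R → ¬ dist θ θ₀ < ε → θ ∈ K :=
    fun θ hθ h1 h2 h3 => ⟨⟨abs_le.1 h1, abs_le.1 h2, hθ⟩, h3⟩
  rcases K.eq_empty_or_nonempty with hE | hE
  · refine ⟨1, one_pos, fun θ hθ h1 h2 _ => ?_⟩
    by_contra h3
    have := hmem θ hθ h1 h2 h3
    rw [hE] at this
    exact this
  · obtain ⟨θm, hθm, hmax⟩ := hKc.exists_isMaxOn hE hP.continuous_criterion.continuousOn
    have hlt : criterion P θm < criterion P θ₀ := hP.criterion_lt hθm.1.2.2 (by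
      rintro rfl
      exact hθm.2 (Metric.mem_ball_self hε))
    refine ⟨criterion P θ₀ - criterion P θm, sub_pos.2 hlt, fun θ hθ h1 h2 h => ?_⟩
    by_contra h3
    have : criterion P θ ≤ criterion P θm := hmax (hmem θ hθ h1 h2 h3)
    linarith

theorem IsModel.exists_lowerIntegral_one_mem [IsProbabilityMeasure P] (hP : IsModel a b P θ₀) :
    ∃ c > 0, ∀ t ∈ Icc a b, c ≤ lowerIntegral P (fun _ => 1) t ∧
      lowerIntegral P (fun _ => 1) t ≤ 1 - c := by
  have heq : ∀ t, lowerIntegral P (fun _ => 1) t = P.real {x | x.2 ≤ t} := fun t => by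
    have h : (fun x : ℝ × ℝ => 1 * (Iic t).indicator (1 : ℝ → ℝ) x.2)
        = {x : ℝ × ℝ | x.2 ≤ t}.indicator 1 := by
      ext x
      by_cases hx : x.2 ≤ t <;> simp [hx]
    rw [lowerIntegral, h, integral_indicator_one (measurableSet_le measurable_snd measurable_const)]
  have h1 : 0 < P.real {x : ℝ × ℝ | x.2 < a} :=
    ENNReal.toReal_pos hP.z_lt.ne' (measure_ne_top _ _)
  have h2 : 0 < P.real {x : ℝ × ℝ | b < x.2} :=
    ENNReal.toReal_pos hP.z_gt.ne' (measure_ne_top _ _)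
  refine ⟨_, lt_min h1 h2, fun t ht => ?_⟩
  rw [heq]
  refine ⟨(min_le_left _ _).trans (measureReal_mono fun x hx => ?_), ?_⟩
  · exact (le_of_lt hx).trans ht.1
  · have hcompl : P.real {x : ℝ × ℝ | x.2 ≤ t} = 1 - P.real {x : ℝ × ℝ | t < x.2} := by
      rw [← probReal_compl_eq_one_sub (measurableSet_lt measurable_const measurable_snd)]
      congr 1
      ext x
      simp
    have hle : P.real {x : ℝ × ℝ | b < x.2} ≤ P.real {x : ℝ × ℝ | t < x.2} :=
      measureReal_mono fun x hx => ht.2.trans_lt hx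
    have := min_le_right (P.real {x : ℝ × ℝ | x.2 < a}) (P.real {x : ℝ × ℝ | b < x.2})
    linarith

/-- Maximizers of the criterion are stable at `P` under uniform closeness of the half-plane
integrals of `1` and `y`. -/
theorem IsModel.exists_dist_lt_of_isMaximizer [IsProbabilityMeasure P] (hP : IsModel a b P θ₀)
    {ε : ℝ} (hε : 0 < ε) :
    ∃ δ > 0, ∀ ν : Measure (ℝ × ℝ), IsProbabilityMeasure ν →
      Integrable (fun x : ℝ × ℝ => x.1) ν → Integrable (fun x : ℝ × ℝ => x.1 ^ 2) ν →
      (∀ t ∈ Icc a b, |lowerIntegral ν (fun _ => 1) t - lowerIntegral P (fun _ => 1) t| ≤ δ) →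
      (∀ t ∈ Icc a b, |lowerIntegral ν (fun x => x.1) t - lowerIntegral P (fun x => x.1) t| ≤ δ) →
      |∫ x, x.1 ∂ν - ∫ x, x.1 ∂P| ≤ δ →
      ∀ θ, IsMaximizer a b (criterion ν) θ → dist θ θ₀ < ε := by
  have hP1 : Integrable (fun x : ℝ × ℝ => x.1) P := hP.memLp_fst.integrable (by norm_num)
  have hcP := criterion_eq hP1 hP.memLp_fst.integrable_sq
  obtain ⟨c, hc, hcp⟩ := hP.exists_lowerIntegral_one_mem
  set p := lowerIntegral P (fun _ => 1)
  set A := lowerIntegral P (fun x => x.1)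
  set T := ∫ x, x.1 ∂P
  set K := ∫ x, |x.1| ∂P with hK
  have hK0 : 0 ≤ K := integral_nonneg fun x => abs_nonneg _
  have hAK : ∀ t, |A t| ≤ K := fun t => by
    refine (abs_integral_le_integral_abs).trans (integral_mono
      (integrable_mul_indicator_Iic hP1 t).abs hP1.abs fun x => abs_mul_indicator_Iic_le _ _ _)
  have hTK : |T| ≤ K := abs_integral_le_integral_abs
  set R₀ := max |θ₀.1| |θ₀.2.1|
  have hR₀ : 0 ≤ R₀ := le_max_of_le_left (abs_nonneg _)
  set G₀ := gain θ₀.1 θ₀.2.1 (p θ₀.2.2) (A θ₀.2.2) T with hG₀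
  -- The constants leave room for any `δ ≤ min 1 (c / 2)`, so that `R` can be fixed before `δ`:
  -- masses stay above `c / 2`, `|T - A|` is at most `2 K + 2 δ`, and the gain at `θ₀` drops by at
  -- most `6 R₀ + 2 R₀²`. The final `1` pays for the inexact maximization.
  obtain ⟨R, hR⟩ := exists_abs_le_of_le_gain (half_pos hc) (K := 2 * K + 2) (by linarith)
    (G₀ - (6 * R₀ + 2 * R₀ ^ 2) - 1)
  set R₁ := max R R₀
  have hR₁ : 0 ≤ R₁ := hR₀.trans (le_max_right _ _)
  set C := 6 * R₁ + 2 * R₁ ^ 2 with hC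
  have hC0 : 0 ≤ C := by positivity
  obtain ⟨η, hη, hgap⟩ := hP.exists_gap R₁ (half_pos hε)
  set δ := min (min 1 (c / 2)) (η / (4 * (C + 1))) with hδ
  have hδ0 : 0 < δ := by positivity
  have hδ1 : δ ≤ 1 := (min_le_left _ _).trans (min_le_left _ _)
  have hδc : δ ≤ c / 2 := (min_le_left _ _).trans (min_le_right _ _)
  have hδη : C * δ ≤ η / 4 := by
    have h1 : δ ≤ η / (4 * (C + 1)) := min_le_right _ _
    rw [le_div_iff₀ (by positivity)] at h1
    nlinarith
  refine ⟨δ, hδ0, fun ν hν h1 h2 hp hA hT θ hθ => ?_⟩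
  -- The budget is `η`: passing between `ν` and `P` costs at most `η / 4` at each of the two
  -- parameters, and near-maximization costs `e ≤ η / 4`. The bound `e ≤ ε / 2` controls the shift
  -- from `θ.2.2` to `s`.
  have hcν := criterion_eq h1 h2
  set e := min (min 1 (ε / 2)) (η / 4) with he
  have he0 : 0 < e := by positivity
  have he1 : e ≤ 1 := (min_le_left _ _).trans (min_le_left _ _)
  have heε : e ≤ ε / 2 := (min_le_left _ _).trans (min_le_right _ _)
  have heη : e ≤ η / 4 := min_le_right _ _
  obtain ⟨s, hs, hsθ, hmax⟩ := hθ.exists_near he0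
  have hmax₀ := hmax θ₀ hP.zeta_mem
  rw [hcν, hcν] at hmax₀
  have hps := hp s hs
  have hAs := hA s hs
  have hcs := hcp s hs
  have hAKs := hAK s
  have hL₀ := abs_gain_sub_gain_le (le_max_left |θ₀.1| |θ₀.2.1|) (le_max_right |θ₀.1| |θ₀.2.1|)
    (hp _ hP.zeta_mem) (hA _ hP.zeta_mem) hT
  have hL₀' : (6 * R₀ + 2 * R₀ ^ 2) * δ ≤ 6 * R₀ + 2 * R₀ ^ 2 :=
    mul_le_of_le_one_right (by positivity) hδ1
  have hL₀'' : (6 * R₀ + 2 * R₀ ^ 2) * δ ≤ C * δ := by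
    have : R₀ ≤ R₁ := le_max_right _ _
    rw [hC]
    gcongr
  have habs : |θ.1| ≤ R ∧ |θ.2.1| ≤ R := by
    refine hR θ.1 θ.2.1 (lowerIntegral ν (fun _ => 1) s) (lowerIntegral ν (fun x => x.1) s)
      (∫ x, x.1 ∂ν) ?_ ?_ ?_ ?_ ?_
    all_goals rw [abs_le] at *
    · linarith [hps.1]
    · linarith [hps.2]
    · constructor <;> linarith [hAs.1, hAs.2, hAKs.1, hAKs.2]
    · constructor <;> linarith [hAs.1, hAs.2, hAKs.1, hAKs.2, hT.1, hT.2, hTK.1, hTK.2]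
    · simp only at hmax₀
      linarith [hL₀.1]
  have hRR₁ : R ≤ R₁ := le_max_left _ _
  have hL := abs_gain_sub_gain_le (habs.1.trans hRR₁) (habs.2.trans hRR₁) hps hAs hT
  have hclose := hgap (θ.1, θ.2.1, s) hs (habs.1.trans hRR₁) (habs.2.trans hRR₁) (by
    rw [hcP, hcP]
    simp only at hmax₀ ⊢
    rw [abs_le] at hL hL₀
    linarith [hL.2, hL₀.1])
  have hsθ' : dist θ (θ.1, θ.2.1, s) < ε / 2 := by
    have : dist θ (θ.1, θ.2.1, s) = |s - θ.2.2| := by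
      rw [Prod.dist_eq, Prod.dist_eq]
      simp [Real.dist_eq, abs_sub_comm]
    rw [this]
    exact hsθ.trans_le heε
  linarith [dist_triangle θ (θ.1, θ.2.1, s) θ₀]

end Model

/-! ### From the function classes to the empirical measures. -/

theorem tendsto_integral_of_classDist {𝓒 : Set (ℝ × ℝ → ℝ)} {Q : ℕ → Measure (ℝ × ℝ)}
    {P : Measure (ℝ × ℝ)} (h : Tendsto (fun n => classDist 𝓒 (Q n) P) atTop (𝓝 0))
    {φ : ℝ × ℝ → ℝ} (hφ : φ ∈ 𝓒) :
    Tendsto (fun n => ∫ x, φ x ∂Q n) atTop (𝓝 (∫ x, φ x ∂P)) := by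
  have h1 : Tendsto (fun n => ENNReal.ofReal |∫ x, φ x ∂Q n - ∫ x, φ x ∂P|) atTop (𝓝 0) :=
    tendsto_of_tendsto_of_tendsto_of_le_of_le tendsto_const_nhds h (fun _ => zero_le)
      fun n => le_iSup₂ (f := fun (φ : ℝ × ℝ → ℝ) (_ : φ ∈ 𝓒) =>
        ENNReal.ofReal |∫ x, φ x ∂Q n - ∫ x, φ x ∂P|) φ hφ
  rw [tendsto_iff_dist_tendsto_zero]
  have h2 := (ENNReal.tendsto_toReal ENNReal.zero_ne_top).comp h1
  refine h2.congr fun n => ?_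
  simp [Real.dist_eq]

theorem indicator_snd_mem_classF {I : Set ℝ} (hI : I.OrdConnected) :
    (fun x : ℝ × ℝ => I.indicator (1 : ℝ → ℝ) x.2) ∈ classF :=
  ⟨I, hI, rfl⟩

theorem one_mem_classF : (fun _ : ℝ × ℝ => (1 : ℝ)) ∈ classF :=
  ⟨univ, ordConnected_univ, by simp⟩

theorem fst_mul_mem_classG (M : ℝ) {f : ℝ × ℝ → ℝ} (hf : f ∈ classF) :
    (fun x : ℝ × ℝ => x.1 * f x) ∈ classG M :=
  Or.inl ⟨f, hf, rfl⟩

theorem abs_fst_mul_mem_classG {M : ℝ} (hM : 0 ≤ M) {f : ℝ × ℝ → ℝ} (hf : f ∈ classF) :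
    (fun x : ℝ × ℝ => |x.1| * f x) ∈ classG M :=
  Or.inr ⟨f, hf, 0, by simpa using hM, by simp⟩

theorem fst_sq_mem_classH : (fun x : ℝ × ℝ => x.1 ^ 2) ∈ classH :=
  ⟨_, one_mem_classF, by simp⟩

/-- The weak law is applied at the finitely many points of Pólya's argument; `φ ≥ 0` provides the
monotonicity in `t`. -/
theorem withHighProb_lowerIntegral_empiricalMeasure {Ω : Type*} [MeasurableSpace Ω]
    {μ : Measure Ω} [IsProbabilityMeasure μ] {m : ℕ → ℕ} (hm_pos : ∀ n, 0 < m n)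
    (hm : Tendsto m atTop atTop) {Q : ℕ → Measure (ℝ × ℝ)} [∀ n, IsProbabilityMeasure (Q n)]
    {X : (n : ℕ) → Fin (m n) → Ω → ℝ × ℝ}
    (hX_law : ∀ n k, HasLaw (X n k) (Q n) μ) (hX_indep : ∀ n, iIndepFun (X n) μ)
    {P : Measure (ℝ × ℝ)} (hPz : ∀ t : ℝ, P.map Prod.snd {t} = 0)
    {φ : ℝ × ℝ → ℝ} (hφ : Measurable φ) (hφ0 : ∀ x, 0 ≤ φ x) (hφP : Integrable φ P)
    (hφQ : ∀ n, MemLp φ 2 (Q n)) {B : ℝ} (hB : ∀ᶠ n in atTop, ∫ x, φ x ^ 2 ∂Q n ≤ B)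
    (hlim : ∀ t, Tendsto (fun n => lowerIntegral (Q n) φ t) atTop (𝓝 (lowerIntegral P φ t)))
    (a b : ℝ) {δ : ℝ} (hδ : 0 < δ) :
    WithHighProb μ fun n ω => ∀ t ∈ Icc a b,
      |lowerIntegral (empiricalMeasure (fun k => X n k ω)) φ t - lowerIntegral P φ t| < δ := by
  obtain ⟨s, hs⟩ := exists_finset_forall_abs_sub_lt (continuous_lowerIntegral hφP hPz)
    (monotone_lowerIntegral hφP hφ0) a b hδ
  refine (WithHighProb.finset_forall s fun t _ => ?_).mono fun n ω h =>
    hs _ (monotone_lowerIntegral (integrable_empiricalMeasure (hm_pos n) _ φ) hφ0) h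
  have hle : ∀ x, |φ x * (Iic t).indicator 1 x.2| ≤ |φ x| :=
    fun x => abs_mul_indicator_Iic_le _ _ _
  have hmeas : Measurable fun x : ℝ × ℝ => φ x * (Iic t).indicator 1 x.2 :=
    hφ.mul (measurable_indicator_Iic_snd t)
  have hL : ∀ n, MemLp (fun x : ℝ × ℝ => φ x * (Iic t).indicator 1 x.2) 2 (Q n) := fun n =>
    (hφQ n).mono hmeas.aestronglyMeasurable (Eventually.of_forall hle)
  refine withHighProb_empiricalMeasure hm_pos hm hX_law hX_indep hmeas hL (B := B) ?_ (hlim t)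
    (half_pos hδ)
  filter_upwards [hB] with n hn
  exact (integral_mono (hL n).integrable_sq (hφQ n).integrable_sq
    fun x => sq_le_sq.2 (hle x)).trans hn

end ChangePoint

end

/-! ### Consistency of the least squares estimator. -/

theorem proposition1
    {Ω : Type*} [MeasurableSpace Ω] (μ : Measure Ω) [IsProbabilityMeasure μ]
    (a b : ℝ)
    -- the limit law and its true parameter
    (P : Measure (ℝ × ℝ)) [IsProbabilityMeasure P] (θ₀ : ℝ × ℝ × ℝ)
    (hP : ChangePoint.IsModel a b P θ₀)
    -- the triangular array: row `n` is a random sample of size `m n` from `Q n`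
    (m : ℕ → ℕ) (hm_pos : ∀ n, 0 < m n) (hm_mono : Monotone m) (hm : Tendsto m atTop atTop)
    (Q : ℕ → Measure (ℝ × ℝ)) [∀ n, IsProbabilityMeasure (Q n)]
    (hQ : ∀ n, Integrable (fun x : ℝ × ℝ => x.1 ^ 2) (Q n))
    (X : (n : ℕ) → Fin (m n) → Ω → ℝ × ℝ)
    (hX_law : ∀ n k, HasLaw (X n k) (Q n) μ)
    (hX_indep : ∀ n, iIndepFun (X n) μ)
    -- `θ n` is a smallest argmax of `θ ↦ Q_n(m_θ)`
    (θ : ℕ → ℝ × ℝ × ℝ)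
    (hθ : ∀ n, ChangePoint.IsSargmax a b (ChangePoint.criterion (Q n)) (θ n))
    (M : ℝ) (hM : 0 < M) (hθM : ∀ n, |(θ n).1| ≤ M)
    -- `θstar n` is a least squares estimator computed from row `n`
    (θstar : ℕ → Ω → ℝ × ℝ × ℝ)
    (hθstar : ∀ n, ∀ᵐ ω ∂μ, ChangePoint.IsSargmax a b
      (ChangePoint.criterion (ChangePoint.empiricalMeasure (fun k => X n k ω))) (θstar n ω))
    -- conditions (I) to (IV)
    (hI : Tendsto (fun n => ChangePoint.classDist ChangePoint.classF (Q n) P) atTop (𝓝 0))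
    (hII : Tendsto (fun n => ChangePoint.classDist (ChangePoint.classG M) (Q n) P) atTop (𝓝 0))
    (hIII : Tendsto (fun n => ChangePoint.classDist ChangePoint.classH (Q n) P) atTop (𝓝 0))
    (hIV : Tendsto θ atTop (𝓝 θ₀)) :
    TendstoInMeasure μ θstar atTop (fun _ => θ₀) := by
  open ChangePoint in
  refine tendstoInMeasure_of_withHighProb fun ε hε => ?_
  obtain ⟨δ, hδ, hstable⟩ := hP.exists_dist_lt_of_isMaximizer hε
  have hyP : Integrable (fun x : ℝ × ℝ => x.1) P := hP.memLp_fst.integrable (by norm_num)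
  have hyQ : ∀ n, MemLp (fun x : ℝ × ℝ => x.1) 2 (Q n) := fun n =>
    (memLp_two_iff_integrable_sq measurable_fst.aestronglyMeasurable).2 (hQ n)
  have hy1Q : ∀ n, Integrable (fun x : ℝ × ℝ => x.1) (Q n) := fun n =>
    (hyQ n).integrable (by norm_num)
  obtain ⟨B, hB⟩ : ∃ B, ∀ᶠ n in atTop, ∫ x, x.1 ^ 2 ∂Q n ≤ B :=
    ⟨_, (tendsto_integral_of_classDist hIII fst_sq_mem_classH).eventually_le_const
      (lt_add_one _)⟩
  have hF : ∀ t : ℝ, (fun x : ℝ × ℝ => (Iic t).indicator (1 : ℝ → ℝ) x.2) ∈ classF :=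
    fun t => indicator_snd_mem_classF ordConnected_Iic
  have hmean : WithHighProb μ fun n ω =>
      |∫ x, x.1 ∂empiricalMeasure (fun k => X n k ω) - ∫ x, x.1 ∂P| < δ :=
    withHighProb_empiricalMeasure hm_pos hm hX_law hX_indep measurable_fst hyQ hB
      (by simpa using tendsto_integral_of_classDist hII (fst_mul_mem_classG M one_mem_classF)) hδ
  have hone := withHighProb_lowerIntegral_empiricalMeasure hm_pos hm hX_law hX_indep hP.z_noAtoms
    (φ := fun _ => 1) measurable_const (fun _ => zero_le_one) (integrable_const 1)
    (fun n => memLp_const 1) (B := 1) (Eventually.of_forall fun n => by simp)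
    (fun t => by simpa [lowerIntegral] using tendsto_integral_of_classDist hI (hF t)) a b hδ
  -- Since `y` changes sign, its half-plane integral need not be monotone in `t`. Writing `y = (y +
  -- |y|) - |y|` gives two nonnegative functions, each controlled to within `δ / 2`.
  have habs_lim : ∀ t, Tendsto (fun n => lowerIntegral (Q n) (fun x => |x.1|) t) atTop
      (𝓝 (lowerIntegral P (fun x => |x.1|) t)) := fun t =>
    tendsto_integral_of_classDist hII (abs_fst_mul_mem_classG hM.le (hF t))
  have habs := withHighProb_lowerIntegral_empiricalMeasure hm_pos hm hX_law hX_indep hP.z_noAtoms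
    (φ := fun x => |x.1|) measurable_fst.abs (fun x => abs_nonneg _) hyP.abs
    (fun n => (hyQ n).abs) (B := B) (by simpa using hB) habs_lim a b (half_pos hδ)
  have hadd : ∀ {ν : Measure (ℝ × ℝ)}, Integrable (fun x : ℝ × ℝ => x.1) ν → ∀ t,
      lowerIntegral ν (fun x => x.1 + |x.1|) t
        = lowerIntegral ν (fun x => x.1) t + lowerIntegral ν (fun x => |x.1|) t := fun h t => by
    simp only [lowerIntegral, add_mul]
    exact integral_add (integrable_mul_indicator_Iic h t) (integrable_mul_indicator_Iic h.abs t)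
  have hsum_sq : ∀ y : ℝ, (y + |y|) ^ 2 ≤ 4 * y ^ 2 := fun y => by
    nlinarith [sq_nonneg (y - |y|), sq_abs y]
  have hsum_mem : ∀ n, MemLp (fun x : ℝ × ℝ => x.1 + |x.1|) 2 (Q n) := fun n =>
    (hyQ n).add (hyQ n).abs
  have hsum := withHighProb_lowerIntegral_empiricalMeasure hm_pos hm hX_law hX_indep hP.z_noAtoms
    (φ := fun x => x.1 + |x.1|) (measurable_fst.add measurable_fst.abs)
    (fun x => by linarith [neg_abs_le x.1]) (hyP.add hyP.abs) hsum_mem (B := 4 * B)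
    (by
      filter_upwards [hB] with n hn
      have h := integral_mono (hsum_mem n).integrable_sq ((hQ n).const_mul 4) fun x => hsum_sq x.1
      rw [integral_const_mul] at h
      linarith)
    (fun t => by
      simp_rw [hadd (hy1Q _), hadd hyP]
      exact (tendsto_integral_of_classDist hII (fst_mul_mem_classG M (hF t))).add (habs_lim t))
    a b (half_pos hδ)
  refine (((hmean.and hone).and habs).and hsum).mono_ae fun n => ?_
  filter_upwards [hθstar n] with ω hω h
  obtain ⟨⟨⟨hT, hp⟩, hA₁⟩, hA₂⟩ := h
  have hint := integrable_empiricalMeasure (hm_pos n) fun k => X n k ω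
  refine hstable _ (isProbabilityMeasure_empiricalMeasure (hm_pos n) _) (hint _) (hint _)
    (fun t ht => (hp t ht).le) (fun t ht => ?_) hT.le _ hω.1
  have h₁ := hA₁ t ht
  have h₂ := hA₂ t ht
  rw [hadd (hint _), hadd hyP] at h₂
  rw [abs_lt] at h₁ h₂
  rw [abs_le]
  constructor <;> linarith [h₁.1, h₁.2, h₂.1, h₂.2]
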